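/- Let $\mathcal X$ be a set, $\mathcal U:\mathcal X\to 2^{\mathcal X}$ a perturbation map, and $\mathcal H\subseteq\{0,1\}^{\mathcal X}$ a nonempty hypothesis class. For $h:\mathcal X\to\{0,1\}$ put $l_{\mathcal U}(h,(x,y))=\sup_{z\in\mathcal U(x)}\mathbf 1[h(z)\ne y]$ (which is $0$ if $\mathcal U(x)=\emptyset$). A $\mathcal U$-adversarial Littlestone tree of depth $d$ is a full binary tree of depth $d$ whose internal nodes $\mathbf u\in\{0,1\}^k$, $0\le k<d$, are labelled by pairs $(x^0_{\mathbf u},x^1_{\mathbf u})\in\mathcal X^2$ with $\mathcal U(x^0_{\mathbf u})\cap\mathcal U(x^1_{\mathbf u})\neq\emptyset$. It is shattered by $\mathcal H$ if for every $\mathbf u\in\{0,1\}^d$ and $0\le k<d$ there is $h\in\mathcal H$ such that for all $0\le i\le k$ and all $z\in\mathcal U(x^{u_{i+1}}_{(u_1,\dots,u_i)})$ one has $h(z)=u_{i+1}$. The dimension $L_{\mathcal U}(\mathcal H)$ is the maximum depth of a shattered tree ($\infty$ if the depths are unbounded). Assume $L:=L_{\mathcal U}(\mathcal H)<\infty$.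 In round $t$ of the robust online game a perturbed input $Z_t$ is revealed, the learner predicts $\hat y_t\in\{0,1\}$, and then $(X_t,Y_t)\in\mathcal X\times\{0,1\}$ with $Z_t\in\mathcal U(X_t)$ is revealed. A deterministic learner determines $\hat y_t$ from the earlier rounds and $Z_t$; a randomized learner determines from them the law of $\hat y_t$ and draws $\hat y_t$ with fresh randomness. The regret on a sequence $S=(Z_t,X_t,Y_t)_{t=1}^T$ is $\sum_{t=1}^T\mathbf 1[\hat y_t\ne Y_t]-\min_{h\in\mathcal H}\sum_{t=1}^T l_{\mathcal U}(h,(X_t,Y_t))$, and $S$ is realizable if some $h\in\mathcal H$ has $\sum_{t=1}^T l_{\mathcal U}(h,(X_t,Y_t))=0$. **Theorem.** There is an absolute constant $C>0$ such that for all $\mathcal X,\mathcal U,\mathcal H,L$ as above there is a deterministic learner $\mathcal B$ making at most $L$ mistakes on every finite realizable sequence, with the following property. For every $T\ge 2$ there is a randomized learner $\mathcal A$ (which knows $T$) whose expected regret on every sequence $S$ of length $T$ with $Z_t\in\mathcal U(X_t)$ for all $t$ is at most $$C\sqrt{T\,L_{\mathcal U}(\mathcal H)\,\log T}.$$ Moreover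 $\mathcal A$ is the exponential-weights forecaster with learning rate $\sqrt{8\log N/T}$ over the $N$ experts $\mathcal A_J$, $J\subseteq[T]$, $|J|\le L$: in each round it draws an expert with probability proportional to $\exp\bigl(-\sqrt{8\log N/T}\cdot(\text{number of past mistakes of the expert})\bigr)$ and predicts as that expert does. Here $\mathcal A_J$ is the lazy version of $\mathcal B$ (a round is added to the history given to $\mathcal B$ only if $\mathcal B$ errs on it), trained only on the earlier rounds whose index lies in $J$. -/

import Mathlib

noncomputable section

open MeasureTheory
open scoped ENNReal

namespace RobustOnline

universe u

variable {X : Type u}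

/-- The adversarial loss `l_U(h, (x, y)) = sup_{z ∈ U x} 1[h z ≠ y]`
(the supremum over an empty perturbation set is `0`). -/
def advLoss (U : X → Set X) (h : X → Bool) (x : X) (y : Bool) : ℝ :=
  ⨆ z : U x, if h z ≠ y then (1 : ℝ) else 0

/-- The adversarial loss is `0` if `h` gives the label `y` to every allowed perturbation of `x`,
and `1` otherwise. -/
theorem advLoss_eq (U : X → Set X) (h : X → Bool) (x : X) (y : Bool) [Decidable (∀ z ∈ U x, h z = y)] :
    advLoss U h x y = if ∀ z ∈ U x, h z = y then 0 else 1 := by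
  unfold advLoss
  split_ifs with hh
  · have : ∀ z : U x, (if h z ≠ y then (1 : ℝ) else 0) = 0 := fun z => by simp [hh z z.2]
    simp only [this]
    exact Real.iSup_const_zero
  · push Not at hh
    obtain ⟨z, hz, hzy⟩ := hh
    have hle : ∀ z : U x, (if h z ≠ y then (1 : ℝ) else 0) ≤ 1 := fun z => by split_ifs <;> norm_num
    have : Nonempty (U x) := ⟨⟨z, hz⟩⟩
    apply le_antisymm (ciSup_le hle)
    have := le_ciSup (f := fun z : U x => if h z ≠ y then (1 : ℝ) else 0)
      ⟨1, by rintro _ ⟨z, rfl⟩; exact hle z⟩ ⟨z, hz⟩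
    simpa [hzy] using this

/-! ### The adversarial Littlestone dimension -/

/-- `tree p b` is the entry `x^b_p` of the label of the node at address `p`, where an address is
the list of the edge labels from the root. Only the nodes with `p.length < d` belong to the tree
of depth `d`. Every label is a pair of instances with a common allowed perturbation. -/
def IsAdvTree (U : X → Set X) (d : ℕ) (tree : List Bool → Bool → X) : Prop :=
  ∀ p : List Bool, p.length < d → (U (tree p false) ∩ U (tree p true)).Nonempty

/-- Every path that starts at the root of the tree of depth `d` is robustly realized by `H`. -/
def Shatters (U : X → Set X) (H : Set (X → Bool)) (d : ℕ) (tree : List Bool → Bool → X) : Prop :=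
  ∀ p : List Bool, p.length = d → ∀ k < d, ∃ h ∈ H, ∀ (i : ℕ) (hi : i < p.length), i ≤ k →
    ∀ z ∈ U (tree (p.take i) p[i]), h z = p[i]

/-- The `U`-adversarial Littlestone dimension: the largest depth of a shattered tree, `⊤` if
there are shattered trees of arbitrarily large depth. -/
def ldim (U : X → Set X) (H : Set (X → Bool)) : ℕ∞ :=
  ⨆ (d : ℕ) (_ : ∃ tree : List Bool → Bool → X, IsAdvTree U d tree ∧ Shatters U H d tree), (d : ℕ∞)

/-! ### The game -/

/-- One round: the perturbed input `z` shown first, then the clean instance `x` with label `y`. -/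
structure Round (X : Type u) where
  z : X
  x : X
  y : Bool

/-- `S` is a sequence that the adversary may play: `Z_t ∈ U(X_t)` in every round. -/
def IsPlay (U : X → Set X) (S : List (Round X)) : Prop :=
  ∀ r ∈ S, r.z ∈ U r.x

/-- A deterministic learner predicts from the earlier rounds and the current perturbed input. -/
abbrev Learner (X : Type u) := List (Round X) → X → Bool

/-- A randomized learner chooses, from the earlier rounds and the current perturbed input, the
law of its current prediction; it draws the prediction with fresh randomness. -/
abbrev RandomizedLearner (X : Type u) := List (Round X) → X → PMF Bool

/-- The number of mistakes of a deterministic learner on `S`; `S.take t` is the history before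
the round with (zero-based) index `t`. -/
def mistakes (A : Learner X) (S : List (Round X)) : ℕ :=
  ∑ t : Fin S.length, if A (S.take t) S[t].z ≠ S[t].y then 1 else 0

/-- The total adversarial loss of the hypothesis `h` on `S`. -/
def totalLoss (U : X → Set X) (h : X → Bool) (S : List (Round X)) : ℝ :=
  ∑ t : Fin S.length, advLoss U h S[t].x S[t].y

/-- `S` is robustly realizable by `H`. -/
def Realizable (U : X → Set X) (H : Set (X → Bool)) (S : List (Round X)) : Prop :=
  ∃ h ∈ H, totalLoss U h S = 0

/-- The regret on `S` of the predictions `yhat`. -/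
def regret (U : X → Set X) (H : Set (X → Bool)) (S : List (Round X))
    (yhat : Fin S.length → Bool) : ℝ :=
  (∑ t : Fin S.length, if yhat t ≠ S[t].y then (1 : ℝ) else 0) - ⨅ h : H, totalLoss U h S

/-- The joint law of the predictions of a randomized learner on the sequence `S`. -/
def predictionLaw (A : RandomizedLearner X) (S : List (Round X)) :
    Measure (Fin S.length → Bool) :=
  Measure.pi fun t : Fin S.length => (A (S.take t) S[t].z).toMeasure

/-- The expected regret of a randomized learner on the sequence `S`. -/
def expectedRegret (U : X → Set X) (H : Set (X → Bool)) (A : RandomizedLearner X)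
    (S : List (Round X)) : ℝ :=
  ∫ yhat, regret U H S yhat ∂(predictionLaw A S)

/-! ### Prediction with expert advice over lazy learners -/

/-- Exponential weights with rate `η` over finitely many experts: draw an expert with probability
proportional to `exp (-η * number of its mistakes so far)` and predict as it does. -/
def expWeights {ι : Type*} [Fintype ι] [Nonempty ι] (η : ℝ) (E : ι → Learner X) :
    RandomizedLearner X := fun hist z =>
  (PMF.normalize (fun i => ENNReal.ofReal (Real.exp (-η * mistakes (E i) hist)))
    (by
      rw [tsum_fintype]
      intro h0
      have := (Finset.sum_eq_zero_iff.mp h0) (Classical.arbitrary ι) (Finset.mem_univ _)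
      exact absurd this (by simp [Real.exp_pos]))
    (by
      rw [tsum_fintype]
      exact ENNReal.sum_ne_top.mpr fun i _ => ENNReal.ofReal_ne_top)).map fun i => E i hist z

/-- The rounds that the lazy version of `B` keeps: a round enters the history of `B` only if `B`,
run on the rounds kept so far, makes a mistake on it. -/
def lazyHistory (B : Learner X) (S : List (Round X)) : List (Round X) :=
  S.foldl (fun kept r => if B kept r.z ≠ r.y then kept ++ [r] else kept) []

/-- The lazy version of `B`, which updates its history only when it makes a mistake. -/
def lazyLearner (B : Learner X) : Learner X := fun S z => B (lazyHistory B S) z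

/-- The subsequence of `S` on the rounds with (zero-based) index in `J`. -/
def subseq (J : Finset ℕ) (S : List (Round X)) : List (Round X) :=
  (S.zipIdx.filter fun p => p.2 ∈ J).map Prod.fst

/-- The expert of `J`: the lazy version of `B`, trained only on the earlier rounds in `J`. -/
def expert (B : Learner X) (J : Finset ℕ) : Learner X :=
  fun hist z => lazyLearner B (subseq J hist) z

/-- The sets of at most `L` of the rounds `0, …, T - 1`. -/
def smallSubsets (T L : ℕ) : Finset (Finset ℕ) :=
  (Finset.range T).powerset.filter fun J => J.card ≤ L

instance (T L : ℕ) : Nonempty (smallSubsets T L) :=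
  ⟨⟨∅, by simp [smallSubsets]⟩⟩

/-- The agnostic learner with horizon `T`: exponential weights, with rate `√(8 log N / T)` for
`N` experts, over the experts of all sets of at most `L` rounds. -/
def agnosticLearner (B : Learner X) (L T : ℕ) : RandomizedLearner X :=
  expWeights (Real.sqrt (8 * Real.log (smallSubsets T L).card / T))
    fun J : smallSubsets T L => expert B J

end RobustOnline

end

noncomputable section

open MeasureTheory
open scoped ENNReal

namespace RobustOnline

universe u

variable {X : Type u}

/-! ### Sums over the rounds of a sequence -/

/-! The realizable learner uses version spaces, ranked by `treeRank`, the dimension plus one. The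
clean instance behind `z` is hidden, but any two candidates `x₀`, `x₁` share the perturbation `z`,
so they form a legal node label. If restricting to `(x₀, false)` and to `(x₁, true)` both kept the
rank, joining the two subtrees would give a tree that is too deep (`treeRank_restrict_lt`). Hence
some prediction lowers the rank whenever it is wrong. The rank starts at most at `L + 1` and stays
positive on realizable sequences, so there are at most `L` mistakes.

In the agnostic case, fix `h` and run the lazy learner on the rounds where `h` is robustly correct.
The rounds it keeps form a realizable sequence on which it always errs, so there are at most `L` of
them. Their indices `J` give an expert with at most `L + totalLoss U h S` mistakes
(`exists_expert`). Exponential weights over at most `(T + 1) ^ L` experts adds at most `√(T L log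
T)`, and the additive `L` is absorbed into the constant. -/

theorem sum_rounds_append {α M : Type*} [AddCommMonoid M] (f : List α → α → M) (S : List α)
    (r : α) :
    (∑ t : Fin (S ++ [r]).length, f ((S ++ [r]).take t) (S ++ [r])[t]) =
      (∑ t : Fin S.length, f (S.take t) S[t]) + f S r := by
  have hl : S.length + 1 = (S ++ [r]).length := by simp
  rw [← (finCongr hl).sum_comp, Fin.sum_univ_castSucc]
  congr 1
  · refine Finset.sum_congr rfl fun t _ => ?_
    have ht : (t : ℕ) < S.length := t.2
    simp [List.take_append_of_le_length ht.le, List.getElem_append_left ht]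
  · simp

theorem mistakes_append (A : Learner X) (S : List (Round X)) (r : Round X) :
    mistakes A (S ++ [r]) = mistakes A S + if A S r.z ≠ r.y then 1 else 0 :=
  sum_rounds_append (fun S r => if A S r.z ≠ r.y then 1 else 0) S r

theorem totalLoss_append (U : X → Set X) (h : X → Bool) (S : List (Round X)) (r : Round X) :
    totalLoss U h (S ++ [r]) = totalLoss U h S + advLoss U h r.x r.y :=
  sum_rounds_append (fun (_ : List (Round X)) r => advLoss U h r.x r.y) S r

/-- The hypothesis `h` is robustly correct on the round `r`. -/
def RobustOn (U : X → Set X) (h : X → Bool) (r : Round X) : Prop :=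
  ∀ z ∈ U r.x, h z = r.y

theorem advLoss_of_robustOn {U : X → Set X} {h : X → Bool} {r : Round X} (hr : RobustOn U h r) :
    advLoss U h r.x r.y = 0 := by
  classical
  rw [advLoss_eq]
  exact if_pos hr

theorem advLoss_of_not_robustOn {U : X → Set X} {h : X → Bool} {r : Round X}
    (hr : ¬ RobustOn U h r) : advLoss U h r.x r.y = 1 := by
  classical
  rw [advLoss_eq]
  exact if_neg hr

theorem advLoss_nonneg (U : X → Set X) (h : X → Bool) (x : X) (y : Bool) :
    0 ≤ advLoss U h x y :=
  Real.iSup_nonneg fun _ => by split_ifs <;> norm_num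

theorem totalLoss_nonneg (U : X → Set X) (h : X → Bool) (S : List (Round X)) :
    0 ≤ totalLoss U h S :=
  Finset.sum_nonneg fun _ _ => advLoss_nonneg _ _ _ _

theorem totalLoss_eq_zero_iff (U : X → Set X) (h : X → Bool) (S : List (Round X)) :
    totalLoss U h S = 0 ↔ ∀ r ∈ S, RobustOn U h r := by
  unfold totalLoss
  rw [Finset.sum_eq_zero_iff_of_nonneg fun _ _ => advLoss_nonneg _ _ _ _]
  constructor
  · intro H r hr
    obtain ⟨i, hi, rfl⟩ := List.getElem_of_mem hr
    by_contra hc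
    have := H ⟨i, hi⟩ (Finset.mem_univ _)
    simp only [Fin.getElem_fin] at this
    rw [advLoss_of_not_robustOn hc] at this
    norm_num at this
  · intro H t _
    exact advLoss_of_robustOn (H _ (List.getElem_mem _))

/-! ### The standard optimal algorithm -/

/-- The hypotheses in `V` which give the label `y` to every allowed perturbation of `x`. -/
def restrict (U : X → Set X) (V : Set (X → Bool)) (x : X) (y : Bool) : Set (X → Bool) :=
  {h ∈ V | ∀ z ∈ U x, h z = y}

/-- The class `V` is nonempty and shatters a tree of depth `n`, in recursive form. -/
def HasShatteredTree (U : X → Set X) : ℕ → Set (X → Bool) → Prop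
  | 0, V => V.Nonempty
  | n + 1, V => ∃ x : Bool → X, (U (x false) ∩ U (x true)).Nonempty ∧
      ∀ b, HasShatteredTree U n (restrict U V (x b) b)

/-- The trees for the two restricted classes are glued below the root; membership in the restricted
class is the constraint at the root. `Nonempty X` only supplies junk labels outside the tree. -/
theorem HasShatteredTree.exists_tree [Nonempty X] {U : X → Set X} {n : ℕ} {V : Set (X → Bool)}
    (hV : HasShatteredTree U n V) :
    ∃ tree : List Bool → Bool → X, IsAdvTree U n tree ∧
      ∀ p : List Bool, p.length = n → ∃ h ∈ V, ∀ (i : ℕ) (hi : i < p.length),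
        ∀ z ∈ U (tree (p.take i) p[i]), h z = p[i] := by
  induction n generalizing V with
  | zero =>
    obtain ⟨h, hh⟩ := hV
    refine ⟨fun _ _ => Classical.arbitrary X, fun p hp => absurd hp (Nat.not_lt_zero _),
      fun p hp => ⟨h, hh, fun i hi => ?_⟩⟩
    omega
  | succ n ih =>
    obtain ⟨x, hx, hb⟩ := hV
    choose tree hadv hsh using fun b => ih (hb b)
    refine ⟨fun p => match p with
      | [] => x
      | b :: q => tree b q, ?_, ?_⟩
    · rintro (_ | ⟨b, q⟩) hp
      · exact hx
      · exact hadv b q (by simpa using hp)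
    · rintro (_ | ⟨b, q⟩) hp
      · simp at hp
      · obtain ⟨h, hh, hq⟩ := hsh b q (by simpa using hp)
        refine ⟨h, hh.1, ?_⟩
        rintro (_ | i) hi
        · exact hh.2
        · exact hq i (by simpa using hi)

theorem HasShatteredTree.le_ldim {U : X → Set X} {n : ℕ} {H : Set (X → Bool)}
    (hH : HasShatteredTree U n H) : (n : ℕ∞) ≤ ldim U H := by
  rcases n with _ | n
  · simp
  have : Nonempty X := by
    obtain ⟨x, -⟩ := hH
    exact ⟨x true⟩
  obtain ⟨tree, hadv, hsh⟩ := hH.exists_tree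
  -- A hypothesis realizing the whole path serves every prefix `k`.
  refine le_iSup₂_of_le (n + 1) ⟨tree, hadv, fun p hp k _ => ?_⟩ le_rfl
  obtain ⟨h, hh, hz⟩ := hsh p hp
  exact ⟨h, hh, fun i hi _ => hz i hi⟩

theorem HasShatteredTree.mono {U : X → Set X} {n : ℕ} {V W : Set (X → Bool)} (hVW : V ⊆ W)
    (hV : HasShatteredTree U n V) : HasShatteredTree U n W := by
  induction n generalizing V W with
  | zero => exact Set.Nonempty.mono hVW hV
  | succ n ih =>
    obtain ⟨x, hx, hb⟩ := hV
    exact ⟨x, hx, fun b => ih (fun h hh => ⟨hVW hh.1, hh.2⟩) (hb b)⟩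

/-- The least depth without a shattered tree, that is, the dimension plus one (and `0` for the
empty class); the junk value is `0` if the dimension is infinite. -/
def treeRank (U : X → Set X) (V : Set (X → Bool)) : ℕ :=
  sInf {n | ¬ HasShatteredTree U n V}

theorem hasShatteredTree_of_lt_treeRank {U : X → Set X} {n : ℕ} {V : Set (X → Bool)}
    (h : n < treeRank U V) : HasShatteredTree U n V :=
  not_not.mp (Nat.notMem_of_lt_sInf h)

theorem treeRank_le {U : X → Set X} {n : ℕ} {V : Set (X → Bool)}
    (h : ¬ HasShatteredTree U n V) : treeRank U V ≤ n :=
  Nat.sInf_le h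

/-- Some failing depth `n` must exist, since otherwise `sInf ∅ = 0` would be a junk value. -/
theorem not_hasShatteredTree_treeRank {U : X → Set X} {n : ℕ} {V : Set (X → Bool)}
    (h : ¬ HasShatteredTree U n V) : ¬ HasShatteredTree U (treeRank U V) V :=
  Nat.sInf_mem (s := {n | ¬ HasShatteredTree U n V}) ⟨n, h⟩

theorem treeRank_pos {U : X → Set X} {n : ℕ} {V : Set (X → Bool)}
    (h : ¬ HasShatteredTree U n V) (hV : V.Nonempty) : 0 < treeRank U V := by
  rw [Nat.pos_iff_ne_zero]
  intro h0
  have := not_hasShatteredTree_treeRank h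
  rw [h0] at this
  exact this hV

theorem treeRank_mono {U : X → Set X} {n : ℕ} {V W : Set (X → Bool)} (hVW : V ⊆ W)
    (h : ¬ HasShatteredTree U n W) : treeRank U V ≤ treeRank U W :=
  treeRank_le fun hV => not_hasShatteredTree_treeRank h (hV.mono hVW)

/-- Two restrictions of `V` to different labels at a common perturbed input cannot both keep the
rank of `V`. -/
theorem treeRank_restrict_lt {U : X → Set X} {n : ℕ} {V : Set (X → Bool)}
    (h : ¬ HasShatteredTree U n V) (hV : V.Nonempty) {z x₀ x₁ : X} (h₀ : z ∈ U x₀)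
    (h₁ : z ∈ U x₁) (hr : treeRank U V ≤ treeRank U (restrict U V x₁ true)) :
    treeRank U (restrict U V x₀ false) < treeRank U V := by
  by_contra! hc
  obtain ⟨m, hm⟩ := Nat.exists_eq_succ_of_ne_zero (treeRank_pos h hV).ne'
  refine not_hasShatteredTree_treeRank h ?_
  rw [hm]
  -- Both restrictions have rank above `m`, so each shatters depth `m`; the root `(x₀, x₁)` is legal
  -- because of `z`, and depth `m + 1 = treeRank U V` is reached.
  refine ⟨fun b => cond b x₁ x₀, ⟨z, h₀, h₁⟩, ?_⟩
  rintro (_ | _) <;> apply hasShatteredTree_of_lt_treeRank <;> simp only [cond] <;> omega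

/-- The hypotheses of `H` which are robustly correct on all rounds of `S`. -/
def versionSpace (U : X → Set X) (H : Set (X → Bool)) (S : List (Round X)) : Set (X → Bool) :=
  {h ∈ H | ∀ r ∈ S, RobustOn U h r}

theorem versionSpace_append (U : X → Set X) (H : Set (X → Bool)) (S : List (Round X))
    (r : Round X) :
    versionSpace U H (S ++ [r]) = restrict U (versionSpace U H S) r.x r.y := by
  ext h
  simp only [versionSpace, restrict, Set.mem_ofPred_eq, List.mem_append, List.mem_singleton,
    RobustOn, or_imp, forall_and, forall_eq, and_assoc]

open Classical in
/-- The standard optimal algorithm: predict `true` if some clean instance compatible with the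
perturbed input allows this label without a decrease of the rank of the version space. -/
def optimalLearner (U : X → Set X) (H : Set (X → Bool)) : Learner X := fun S z =>
  decide (∃ x, z ∈ U x ∧
    treeRank U (versionSpace U H S) ≤ treeRank U (restrict U (versionSpace U H S) x true))

/-- The rank is a potential: it never increases, and each mistake lowers it by at least one. -/
theorem mistakes_optimalLearner_add_treeRank_le {U : X → Set X} {H : Set (X → Bool)} {n : ℕ}
    (hn : ¬ HasShatteredTree U n H) (S : List (Round X)) (hS : IsPlay U S)
    (hne : (versionSpace U H S).Nonempty) :
    mistakes (optimalLearner U H) S + treeRank U (versionSpace U H S) ≤ n := by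
  induction S using List.reverseRecOn with
  | nil => simpa [mistakes, versionSpace] using treeRank_le hn
  | append_singleton S r ih =>
    have hsub : versionSpace U H (S ++ [r]) ⊆ versionSpace U H S := by
      rw [versionSpace_append]
      exact fun h hh => hh.1
    have hn' : ¬ HasShatteredTree U n (versionSpace U H S) :=
      fun hc => hn (hc.mono fun h hh => hh.1)
    have hne' := hne.mono hsub
    have hr : r.z ∈ U r.x := hS r (by simp)
    have ih := ih (fun q hq => hS q (by simp [hq])) hne'
    rw [mistakes_append]
    split_ifs with hm
    · suffices treeRank U (versionSpace U H (S ++ [r])) < treeRank U (versionSpace U H S) by omega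
      rw [versionSpace_append]
      -- On a wrong `true`, the witness `x` behind the prediction is paired with `r.x`. On a wrong
      -- `false`, `r.x` itself failed to be a witness, so its restriction lost rank.
      rcases hy : r.y with _ | _
      · rw [hy] at hm
        obtain ⟨x, hx, hle⟩ : ∃ x, r.z ∈ U x ∧ treeRank U (versionSpace U H S) ≤
            treeRank U (restrict U (versionSpace U H S) x true) := by
          simpa [optimalLearner] using hm
        exact treeRank_restrict_lt hn' hne' hr hx hle
      · rw [hy] at hm
        by_contra! hc
        exact hm (by simpa [optimalLearner] using ⟨r.x, hr, hc⟩)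
    · have := treeRank_mono hsub hn'
      omega

theorem mistakes_optimalLearner_le {U : X → Set X} {H : Set (X → Bool)} {L : ℕ}
    (hL : ldim U H = L) (S : List (Round X)) (hS : IsPlay U S) (hr : Realizable U H S) :
    mistakes (optimalLearner U H) S ≤ L := by
  have hn : ¬ HasShatteredTree U (L + 1) H := by
    intro hc
    have := hc.le_ldim
    rw [hL, Nat.cast_le] at this
    omega
  obtain ⟨h, hh, hl⟩ := hr
  have hne : (versionSpace U H S).Nonempty := ⟨h, hh, (totalLoss_eq_zero_iff U h S).mp hl⟩
  have := mistakes_optimalLearner_add_treeRank_le hn S hS hne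
  -- Positivity of the final rank turns the bound `L + 1` into `L`.
  have := treeRank_pos (fun hc => hn (hc.mono fun h hh => hh.1)) hne
  omega

/-! ### Lazy experts -/

theorem lazyHistory_append (B : Learner X) (S : List (Round X)) (r : Round X) :
    lazyHistory B (S ++ [r]) =
      if B (lazyHistory B S) r.z ≠ r.y then lazyHistory B S ++ [r] else lazyHistory B S := by
  simp [lazyHistory]

/-- Within the kept sequence, each round is preceded by exactly the history on which `B` erred when
the round was added. -/
theorem mistakes_lazyHistory (B : Learner X) (S : List (Round X)) :
    mistakes B (lazyHistory B S) = (lazyHistory B S).length := by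
  induction S using List.reverseRecOn with
  | nil => simp [lazyHistory, mistakes]
  | append_singleton S r ih =>
    rw [lazyHistory_append]
    split_ifs with h
    · rw [mistakes_append, ih, if_pos h, List.length_append, List.length_singleton]
    · exact ih

theorem mem_of_mem_lazyHistory {B : Learner X} {S : List (Round X)} {q : Round X}
    (hq : q ∈ lazyHistory B S) : q ∈ S := by
  induction S using List.reverseRecOn with
  | nil => simp [lazyHistory] at hq
  | append_singleton S r ih =>
    rw [lazyHistory_append] at hq
    split_ifs at hq
    · rcases List.mem_append.mp hq with hq | hq
      · exact List.mem_append_left _ (ih hq)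
      · exact List.mem_append_right _ hq
    · exact List.mem_append_left _ (ih hq)

theorem subseq_append (J : Finset ℕ) (S : List (Round X)) (r : Round X) :
    subseq J (S ++ [r]) = if S.length ∈ J then subseq J S ++ [r] else subseq J S := by
  unfold subseq
  rw [List.zipIdx_append]
  split_ifs with h <;> simp [h]

theorem subseq_insert {J : Finset ℕ} {n : ℕ} {S : List (Round X)} (hn : S.length ≤ n) :
    subseq (insert n J) S = subseq J S := by
  induction S using List.reverseRecOn with
  | nil => simp [subseq]
  | append_singleton S r ih =>
    rw [List.length_append, List.length_singleton] at hn
    have : S.length ≠ n := by omega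
    simp only [subseq_append, ih (by omega), Finset.mem_insert, this, false_or]

/-- Past predictions cannot depend on whether the current or a later round belongs to `J`, so `J`
can be built one round at a time. -/
theorem mistakes_expert_insert (B : Learner X) {J : Finset ℕ} {n : ℕ} {S : List (Round X)}
    (hn : S.length ≤ n) : mistakes (expert B (insert n J)) S = mistakes (expert B J) S := by
  unfold mistakes expert
  refine Finset.sum_congr rfl fun t _ => ?_
  rw [subseq_insert ((List.length_take_le' _ _).trans hn)]

open Classical in
/-- For every hypothesis some expert makes few mistakes more than the robust loss of the
hypothesis: the expert of the rounds on which the lazy learner errs when it is run on the rounds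
on which the hypothesis is robustly correct. -/
theorem exists_expert (U : X → Set X) (B : Learner X) (h : X → Bool) (S : List (Round X)) :
    ∃ J ⊆ Finset.range S.length,
      J.card ≤ (lazyHistory B (S.filter fun r => RobustOn U h r)).length ∧
      lazyHistory B (subseq J S) = lazyHistory B (S.filter fun r => RobustOn U h r) ∧
      (mistakes (expert B J) S : ℝ) ≤
        (lazyHistory B (S.filter fun r => RobustOn U h r)).length + totalLoss U h S := by
  induction S using List.reverseRecOn with
  | nil => exact ⟨∅, by simp, by simp, by simp [subseq], by simp [mistakes, totalLoss]⟩
  | append_singleton S r ih =>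
    obtain ⟨J, hJ, hcard, hlazy, hmis⟩ := ih
    have hnot : S.length ∉ J := fun hc => by simpa using hJ hc
    have hJ' : J ⊆ Finset.range (S ++ [r]).length :=
      hJ.trans (Finset.range_mono (by simp))
    -- The invariant `hlazy` makes the expert predict exactly as the lazy run on the robustly
    -- correct rounds.
    have hE : expert B J S r.z = B (lazyHistory B (S.filter fun r => RobustOn U h r)) r.z := by
      rw [← hlazy]; rfl
    rw [List.filter_append, totalLoss_append]
    by_cases hr : RobustOn U h r
    · have hf : [r].filter (fun r => RobustOn U h r) = [r] := by simp [hr]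
      rw [hf, lazyHistory_append, advLoss_of_robustOn hr]
      by_cases hm : B (lazyHistory B (S.filter fun r => RobustOn U h r)) r.z ≠ r.y
      · rw [if_pos hm]
        refine ⟨insert S.length J, ?_, ?_, ?_, ?_⟩
        · exact Finset.insert_subset (by simp) hJ'
        · rw [Finset.card_insert_of_notMem hnot, List.length_append, List.length_singleton]
          omega
        · rw [subseq_append, if_pos (Finset.mem_insert_self _ _), subseq_insert le_rfl,
            lazyHistory_append, hlazy, if_pos hm]
        · rw [mistakes_append, mistakes_expert_insert B le_rfl, List.length_append,
            List.length_singleton]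
          -- The kept round adds one to the length, which pays for a possible mistake.
          push_cast
          split_ifs <;> linarith
      · rw [if_neg hm]
        refine ⟨J, hJ', hcard, ?_, ?_⟩
        · rw [subseq_append, if_neg hnot, hlazy]
        · rw [mistakes_append, hE, if_neg hm]
          simpa using hmis
    · have hf : [r].filter (fun r => RobustOn U h r) = [] := by simp [hr]
      rw [hf, List.append_nil, advLoss_of_not_robustOn hr]
      refine ⟨J, hJ', hcard, ?_, ?_⟩
      · rw [subseq_append, if_neg hnot, hlazy]
      -- Here `h` has loss one, which pays for whatever the expert does.
      · rw [mistakes_append]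
        push_cast
        split_ifs <;> linarith

/-- The mistake bound of `B` is applied to the kept rounds themselves: they are a legal play
realized by `h`, and `B` errs on all of them, so their number is at most `L`. -/
theorem exists_expert_mistakes_le {U : X → Set X} {H : Set (X → Bool)} {B : Learner X} {L : ℕ}
    (hB : ∀ S : List (Round X), IsPlay U S → Realizable U H S → mistakes B S ≤ L)
    {S : List (Round X)} (hS : IsPlay U S) {h : X → Bool} (hh : h ∈ H) :
    ∃ J ∈ smallSubsets S.length L, (mistakes (expert B J) S : ℝ) ≤ L + totalLoss U h S := by
  classical
  obtain ⟨J, hJ, hcard, -, hmis⟩ := exists_expert U B h S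
  have hK : (lazyHistory B (S.filter fun r => RobustOn U h r)).length ≤ L := by
    rw [← mistakes_lazyHistory]
    refine hB _ (fun r hr => hS r ?_) ⟨h, hh, (totalLoss_eq_zero_iff U h _).mpr fun r hr => ?_⟩
    · exact List.mem_of_mem_filter (mem_of_mem_lazyHistory hr)
    · simpa using List.of_mem_filter (mem_of_mem_lazyHistory hr)
  have hK' : ((lazyHistory B (S.filter fun r => RobustOn U h r)).length : ℝ) ≤ L := by
    exact_mod_cast hK
  refine ⟨J, ?_, hmis.trans (by linarith)⟩
  simp only [smallSubsets, Finset.mem_filter, Finset.mem_powerset]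
  exact ⟨hJ, hcard.trans hK⟩

/-! ### The exponential-weights forecaster -/

/-- The expected number of mistakes of a randomized learner. -/
def expectedMistakes (A : RandomizedLearner X) (S : List (Round X)) : ℝ :=
  ∑ t : Fin S.length, ∫ b, (if b ≠ S[t].y then (1 : ℝ) else 0) ∂(A (S.take t) S[t].z).toMeasure

theorem expectedMistakes_append (A : RandomizedLearner X) (S : List (Round X)) (r : Round X) :
    expectedMistakes A (S ++ [r]) = expectedMistakes A S +
      ∫ b, (if b ≠ r.y then (1 : ℝ) else 0) ∂(A S r.z).toMeasure :=
  sum_rounds_append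
    (fun S r => ∫ b, (if b ≠ r.y then (1 : ℝ) else 0) ∂(A S r.z).toMeasure) S r

/-- Linearity of expectation: only the marginals of the product law matter, and the comparator is
constant. -/
theorem expectedRegret_eq (U : X → Set X) (H : Set (X → Bool)) (A : RandomizedLearner X)
    (S : List (Round X)) :
    expectedRegret U H A S = expectedMistakes A S - ⨅ h : H, totalLoss U h S := by
  unfold expectedRegret regret predictionLaw expectedMistakes
  rw [integral_sub .of_finite .of_finite, integral_const, integral_finsetSum _ fun _ _ => .of_finite]
  simp only [probReal_univ, one_smul]
  congr 1
  refine Finset.sum_congr rfl fun t _ => ?_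
  exact integral_comp_eval (μ := fun t : Fin S.length => (A (S.take t) S[t].z).toMeasure) (i := t)
    (f := fun b => if b ≠ S[t].y then (1 : ℝ) else 0)
    (measurable_of_finite _).aestronglyMeasurable

theorem expectedMistakes_le_length (A : RandomizedLearner X) (S : List (Round X)) :
    expectedMistakes A S ≤ S.length := by
  unfold expectedMistakes
  refine (Finset.sum_le_card_nsmul _ _ 1 fun t _ => ?_).trans (by simp)
  refine (integral_mono (g := fun _ => (1 : ℝ)) .of_finite .of_finite fun b => ?_).trans (by simp)
  dsimp only
  split_ifs <;> norm_num

/-- Hoeffding's lemma for a Bernoulli variable. -/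
theorem bernoulli_exp_le (η : ℝ) {p : ℝ} (h0 : 0 ≤ p) (h1 : p ≤ 1) :
    1 - p + p * Real.exp (-η) ≤ Real.exp (-η * p + η ^ 2 / 8) := by
  let q : unitInterval := ⟨p, h0, h1⟩
  have h := (ProbabilityTheory.hasSubgaussianMGF_of_mem_Icc (X := fun b : Bool => cond b (1 : ℝ) 0)
    (μ := ProbabilityTheory.bernoulliMeasure true false q) (a := 0) (b := 1)
    (measurable_of_finite _).aemeasurable
    (.of_forall fun b => by cases b <;> simp)).mgf_le (-η)
  simp only [ProbabilityTheory.mgf, ProbabilityTheory.integral_bernoulliMeasure, cond, smul_eq_mul,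
    mul_one, mul_zero, add_zero, q] at h
  have hc : (((‖(1 : ℝ) - 0‖₊ / 2) ^ 2 : NNReal) : ℝ) = 1 / 4 := by norm_num
  rw [hc] at h
  -- Multiplying by `exp (-η p)` undoes the centering in the moment generating function.
  have h := mul_le_mul_of_nonneg_left h (Real.exp_pos (-η * p)).le
  rw [mul_add, mul_left_comm, mul_left_comm _ (1 - p), ← Real.exp_add, ← Real.exp_add,
    ← Real.exp_add] at h
  ring_nf at h ⊢
  simp only [Real.exp_zero] at h
  linarith

section ExpWeights

variable {ι : Type*} [Fintype ι] [Nonempty ι]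

theorem integral_expWeights (η : ℝ) (E : ι → Learner X) (S : List (Round X)) (z : X)
    (g : Bool → ℝ) :
    ∫ b, g b ∂(expWeights η E S z).toMeasure =
      (∑ i, Real.exp (-η * mistakes (E i) S) * g (E i S z)) /
        ∑ i, Real.exp (-η * mistakes (E i) S) := by
  let : MeasurableSpace ι := ⊤
  unfold expWeights
  rw [← PMF.toMeasure_map _ _ (measurable_of_finite _),
    integral_map (measurable_of_finite _).aemeasurable (measurable_of_finite _).aestronglyMeasurable,
    PMF.integral_eq_sum, Finset.sum_div]
  refine Finset.sum_congr rfl fun i _ => ?_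
  rw [PMF.normalize_apply, tsum_fintype, ← ENNReal.ofReal_sum_of_nonneg fun _ _ => (Real.exp_pos _).le,
    ENNReal.toReal_mul, ENNReal.toReal_inv, ENNReal.toReal_ofReal (Real.exp_pos _).le,
    ENNReal.toReal_ofReal (Finset.sum_nonneg fun _ _ => (Real.exp_pos _).le), smul_eq_mul]
  ring

/-- Each round multiplies the total weight by `1 - p + p * exp (-η)`, where `p` is the forecaster's
error probability; Hoeffding's lemma bounds this factor. -/
theorem sum_exp_mistakes_le (η : ℝ) (E : ι → Learner X) (S : List (Round X)) :
    ∑ i, Real.exp (-η * mistakes (E i) S) ≤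
      Fintype.card ι *
        Real.exp (-η * expectedMistakes (expWeights η E) S + S.length * (η ^ 2 / 8)) := by
  induction S using List.reverseRecOn with
  | nil => simp [mistakes, expectedMistakes]
  | append_singleton S r ih =>
    set W := ∑ i, Real.exp (-η * mistakes (E i) S) with hW
    have hWpos : 0 < W := Finset.sum_pos (fun _ _ => Real.exp_pos _) Finset.univ_nonempty
    set p := ∫ b, (if b ≠ r.y then (1 : ℝ) else 0) ∂(expWeights η E S r.z).toMeasure with hp
    have hpW : p * W =
        ∑ i, Real.exp (-η * mistakes (E i) S) * (if E i S r.z ≠ r.y then (1 : ℝ) else 0) := by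
      rw [hp, integral_expWeights, div_mul_cancel₀ _ hWpos.ne']
    have h0 : 0 ≤ p := integral_nonneg fun b => by dsimp only; split_ifs <;> norm_num
    have h1 : p ≤ 1 := by
      refine (integral_mono (g := fun _ => (1 : ℝ)) .of_finite .of_finite fun b => ?_).trans
        (by simp)
      dsimp only
      split_ifs <;> norm_num
    have hstep : ∑ i, Real.exp (-η * mistakes (E i) (S ++ [r])) =
        W * (1 - p + p * Real.exp (-η)) := by
      have : W * (1 - p + p * Real.exp (-η)) = W + (p * W) * (Real.exp (-η) - 1) := by ring
      rw [this, hpW, hW, Finset.sum_mul, ← Finset.sum_add_distrib]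
      refine Finset.sum_congr rfl fun i _ => ?_
      rw [mistakes_append]
      split_ifs
      · push_cast
        rw [mul_add, Real.exp_add]
        ring_nf
      · simp
    rw [hstep, expectedMistakes_append, List.length_append, List.length_singleton]
    calc W * (1 - p + p * Real.exp (-η))
        ≤ (Fintype.card ι *
            Real.exp (-η * expectedMistakes (expWeights η E) S + S.length * (η ^ 2 / 8))) *
              Real.exp (-η * p + η ^ 2 / 8) :=
          mul_le_mul ih (bernoulli_exp_le η h0 h1)
            (add_nonneg (by linarith) (mul_nonneg h0 (Real.exp_pos _).le)) (by positivity)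
      _ = _ := by
          rw [mul_assoc, ← Real.exp_add]
          congr 2
          push_cast
          ring

/-- A single expert's weight is at most the total weight; taking logarithms and dividing by `η`
gives the bound. -/
theorem expectedMistakes_expWeights_le {η : ℝ} (hη : 0 < η) (E : ι → Learner X)
    (S : List (Round X)) (i : ι) :
    expectedMistakes (expWeights η E) S ≤
      mistakes (E i) S + Real.log (Fintype.card ι) / η + S.length * η / 8 := by
  have h := (Finset.single_le_sum (f := fun i => Real.exp (-η * mistakes (E i) S))
    (fun _ _ => (Real.exp_pos _).le) (Finset.mem_univ i)).trans (sum_exp_mistakes_le η E S)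
  have hc : (0 : ℝ) < Fintype.card ι := by exact_mod_cast Fintype.card_pos
  have h := Real.log_le_log (Real.exp_pos _) h
  rw [Real.log_exp, Real.log_mul hc.ne' (Real.exp_pos _).ne', Real.log_exp] at h
  refine le_of_mul_le_mul_left ?_ hη
  have : η * (mistakes (E i) S + Real.log (Fintype.card ι) / η + S.length * η / 8) =
      η * mistakes (E i) S + Real.log (Fintype.card ι) + S.length * (η ^ 2 / 8) := by
    field_simp
  rw [this]
  linarith

/-- With one expert the tuned rate is `0`, which the bound for `0 < η` does not cover. -/
theorem expectedMistakes_expWeights_of_card_eq_one (η : ℝ) (E : ι → Learner X)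
    (hι : Fintype.card ι = 1) (S : List (Round X)) (i : ι) :
    expectedMistakes (expWeights η E) S = mistakes (E i) S := by
  have : Subsingleton ι := Fintype.card_le_one_iff_subsingleton.mp hι.le
  have huniv : (Finset.univ : Finset ι) = {i} :=
    Finset.eq_singleton_iff_unique_mem.mpr ⟨Finset.mem_univ _, fun j _ => Subsingleton.elim _ _⟩
  induction S using List.reverseRecOn with
  | nil => simp [mistakes, expectedMistakes]
  | append_singleton S r ih =>
    rw [expectedMistakes_append, mistakes_append, ih, integral_expWeights, huniv,
      Finset.sum_singleton, Finset.sum_singleton, mul_div_cancel_left₀ _ (Real.exp_pos _).ne']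
    push_cast
    rfl

/-- The regret bound of the exponential-weights forecaster with the tuned learning rate. -/
theorem expectedMistakes_expWeights_tuned_le (E : ι → Learner X) (S : List (Round X))
    (hS : S ≠ []) (i : ι) :
    expectedMistakes (expWeights (Real.sqrt (8 * Real.log (Fintype.card ι) / S.length)) E) S ≤
      mistakes (E i) S + Real.sqrt (S.length * Real.log (Fintype.card ι) / 2) := by
  rcases (Nat.succ_le_of_lt (Fintype.card_pos (α := ι))).eq_or_lt with h1 | h1
  · rw [expectedMistakes_expWeights_of_card_eq_one _ E h1.symm S i]
    exact le_add_of_nonneg_right (Real.sqrt_nonneg _)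
  · have hT : (0 : ℝ) < S.length := by exact_mod_cast List.length_pos_iff.mpr hS
    have hlog : 0 < Real.log (Fintype.card ι) := Real.log_pos (by exact_mod_cast h1)
    set T := (S.length : ℝ)
    set l := Real.log (Fintype.card ι)
    set η := Real.sqrt (8 * l / T) with hη
    have hηpos : 0 < η := Real.sqrt_pos.mpr (by positivity)
    have hsq : η ^ 2 = 8 * l / T := Real.sq_sqrt (by positivity)
    -- At this rate the terms `l / η` and `T * η / 8` are equal.
    have hl : l = η ^ 2 * T / 8 := by rw [hsq]; field_simp
    refine (expectedMistakes_expWeights_le hηpos E S i).trans ?_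
    rw [add_assoc]
    gcongr
    refine Real.le_sqrt_of_sq_le (le_of_eq ?_)
    change (l / η + T * η / 8) ^ 2 = T * l / 2
    rw [hl]
    field_simp
    ring

end ExpWeights

/-! ### The regret bound -/

/-- Termwise comparison of `∑ T.choose i` with the binomial expansion `∑ T ^ i * L.choose i`. -/
theorem card_smallSubsets_le (T L : ℕ) : (smallSubsets T L).card ≤ (T + 1) ^ L := by
  have hsub : smallSubsets T L ⊆
      (Finset.range (L + 1)).biUnion fun i => (Finset.range T).powersetCard i := by
    intro J hJ
    simp only [smallSubsets, Finset.mem_filter, Finset.mem_powerset] at hJ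
    simp only [Finset.mem_biUnion, Finset.mem_range, Finset.mem_powersetCard]
    exact ⟨J.card, by omega, hJ.1, rfl⟩
  refine (Finset.card_le_card hsub).trans (Finset.card_biUnion_le.trans ?_)
  rw [add_pow]
  refine Finset.sum_le_sum fun i hi => ?_
  rw [Finset.card_powersetCard, Finset.card_range, one_pow, mul_one]
  have : 1 ≤ L.choose i := Nat.choose_pos (by simpa [Nat.lt_succ_iff] using hi)
  calc T.choose i ≤ T ^ i * 1 := by simpa using Nat.choose_le_pow T i
    _ ≤ T ^ i * L.choose i := Nat.mul_le_mul_left _ this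

/-- Uses `T + 1 ≤ T ^ 2`; the resulting factor `2` cancels the `1 / 2` under the root in the
forecaster's bound. -/
theorem log_card_smallSubsets_le {T : ℕ} (hT : 2 ≤ T) (L : ℕ) :
    Real.log (smallSubsets T L).card ≤ 2 * (L * Real.log T) := by
  have hT' : (2 : ℝ) ≤ T := by exact_mod_cast hT
  have hpos : (0 : ℝ) < (smallSubsets T L).card := by
    exact_mod_cast Finset.card_pos.mpr (Finset.nonempty_coe_sort.mp inferInstance)
  calc Real.log (smallSubsets T L).card ≤ Real.log (((T : ℝ) ^ 2) ^ L) := by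
        refine Real.log_le_log hpos ?_
        calc ((smallSubsets T L).card : ℝ) ≤ ((T : ℝ) + 1) ^ L := by
              exact_mod_cast card_smallSubsets_le T L
          _ ≤ ((T : ℝ) ^ 2) ^ L := by gcongr; nlinarith
    _ = 2 * (L * Real.log T) := by
        rw [Real.log_pow, Real.log_pow]; push_cast; ring

theorem expectedMistakes_agnosticLearner_le {U : X → Set X} {H : Set (X → Bool)} {B : Learner X}
    {L : ℕ} (hB : ∀ S : List (Round X), IsPlay U S → Realizable U H S → mistakes B S ≤ L)
    {S : List (Round X)} (hlen : 2 ≤ S.length) (hS : IsPlay U S) {h : X → Bool} (hh : h ∈ H) :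
    expectedMistakes (agnosticLearner B L S.length) S ≤
      L + Real.sqrt (S.length * L * Real.log S.length) + totalLoss U h S := by
  obtain ⟨J, hJ, hmis⟩ := exists_expert_mistakes_le hB hS hh
  have hne : S ≠ [] := by rintro rfl; simp at hlen
  have := expectedMistakes_expWeights_tuned_le
    (fun J : smallSubsets S.length L => expert B J) S hne ⟨J, hJ⟩
  rw [Fintype.card_coe] at this
  have hsq : Real.sqrt (S.length * Real.log (smallSubsets S.length L).card / 2) ≤
      Real.sqrt (S.length * L * Real.log S.length) := by
    apply Real.sqrt_le_sqrt
    have := mul_le_mul_of_nonneg_left (log_card_smallSubsets_le hlen L)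
      (Nat.cast_nonneg (α := ℝ) S.length)
    linarith
  unfold agnosticLearner
  dsimp only at this
  linarith

theorem expectedRegret_agnosticLearner_le {U : X → Set X} {H : Set (X → Bool)}
    (hH : H.Nonempty) {B : Learner X} {L : ℕ}
    (hB : ∀ S : List (Round X), IsPlay U S → Realizable U H S → mistakes B S ≤ L)
    {S : List (Round X)} (hlen : 2 ≤ S.length) (hS : IsPlay U S) :
    expectedRegret U H (agnosticLearner B L S.length) S ≤
      3 * Real.sqrt (S.length * L * Real.log S.length) := by
  rw [expectedRegret_eq]
  have : Nonempty H := hH.to_subtype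
  have hT : (2 : ℝ) ≤ S.length := by exact_mod_cast hlen
  have hlog : 1 / 2 ≤ Real.log S.length := by
    have := Real.log_two_gt_d9
    have := Real.log_le_log (by norm_num) hT
    linarith
  -- For `m ≤ min(T, L)`, `m ^ 2 ≤ T L`, and `log T ≥ 1 / 2` inserts the logarithm. This absorbs the
  -- additive `L` if `L ≤ T`; otherwise the trivial bound of `T` mistakes is absorbed instead. With
  -- the forecaster's own root the constant is `2 + 1 = 3`.
  have hmin : ∀ m : ℝ, 0 ≤ m → m ≤ S.length → m ≤ L →
      m ≤ 2 * Real.sqrt (S.length * L * Real.log S.length) := by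
    intro m h0 h1 h2
    have h4 : m / 2 ≤ Real.sqrt (S.length * L * Real.log S.length) := by
      refine Real.le_sqrt_of_sq_le ?_
      have h3 : m * m ≤ S.length * L := mul_le_mul h1 h2 h0 (by positivity)
      have h5 : (S.length * L : ℝ) * (1 / 2) ≤ S.length * L * Real.log S.length := by gcongr
      nlinarith [mul_self_nonneg m]
    linarith
  have hsqrt := Real.sqrt_nonneg (S.length * L * Real.log S.length)
  rcases le_total L S.length with hL | hL
  · have hL2 := hmin (L : ℝ) (by positivity) (by exact_mod_cast hL) le_rfl
    have : expectedMistakes (agnosticLearner B L S.length) S -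
        3 * Real.sqrt (S.length * L * Real.log S.length) ≤ ⨅ h : H, totalLoss U h S :=
      le_ciInf fun h => by
        have := expectedMistakes_agnosticLearner_le hB hlen hS h.2
        linarith
    linarith
  · have hT2 := hmin (S.length : ℝ) (by positivity) le_rfl (by exact_mod_cast hL)
    have h1 := expectedMistakes_le_length (agnosticLearner B L S.length) S
    have h2 : 0 ≤ ⨅ h : H, totalLoss U h S := Real.iInf_nonneg fun h => totalLoss_nonneg U h S
    linarith

end RobustOnline

end

open RobustOnline in
theorem mainTheorem2 :
    ∃ C : ℝ, 0 < C ∧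
      ∀ (X : Type*) (U : X → Set X) (H : Set (X → Bool)) (L : ℕ),
        H.Nonempty → ldim U H = (L : ℕ∞) →
          ∃ B : Learner X,
            (∀ S : List (Round X), IsPlay U S → Realizable U H S → mistakes B S ≤ L) ∧
            ∀ T : ℕ, 2 ≤ T →
              ∃ A : RandomizedLearner X, A = agnosticLearner B L T ∧
                ∀ S : List (Round X), S.length = T → IsPlay U S →
                  expectedRegret U H A S ≤ C * Real.sqrt (T * L * Real.log T) := by
  refine ⟨3, by norm_num, fun X U H L hH hL => ⟨optimalLearner U H,
    mistakes_optimalLearner_le hL, fun T hT => ⟨_, rfl, ?_⟩⟩⟩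
  rintro S rfl hS
  exact expectedRegret_agnosticLearner_le hH (mistakes_optimalLearner_le hL) hT hS
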